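/- For $n\ge 1$ let $\mathrm{QAP}_n=\operatorname{conv}\{yy^{T} : y=\operatorname{vec}(P_\sigma),\ \sigma\in S_n\}\subset\mathbb{R}^{n^2\times n^2}$, where $P_\sigma$ is the $n\times n$ permutation matrix of $\sigma$; the entries of $Y\in\mathbb{R}^{n^2\times n^2}$ are written $Y_{ij,kl}$ with $i,j,k,l\in[n]$. A relaxation of $\mathrm{QAP}_n$ is the solution set $R\subset\mathbb{R}^{n^2\times n^2}$ of a system of linear inequalities such that $\mathrm{QAP}_n\subseteq R$. The QAP5 inequalities are $$\sum_{i,j,k,l\in[n]} n_{ij}n_{kl}\,Y_{ij,kl}-(2\beta-1)\sum_{i,j\in[n]} n_{ij}\,Y_{ij,ij}\ \ge\ \tfrac14-\left(\beta-\tfrac12\right)^2,$$ one for each choice of integers $\beta$ and $n_{ij}$ ($i,j\in[n]$). The extension complexity $\mathrm{xc}(R)$ of $R\subset\mathbb{R}^d$ is the minimum number of facets of a polytope $Q\subset\mathbb{R}^{d+r}$, over all $r\ge 0$, with $R=\{x\in\mathbb{R}^d : \exists y\in\mathbb{R}^r,\ (x,y)\in Q\}$ (and $\mathrm{xc}(R)=\infty$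 if there is no such $Q$, i.e. if $R$ is not a polytope). Theorem. Let $R_n$ be any bounded relaxation of $\mathrm{QAP}_n$ for which all the QAP5 inequalities are valid. Then $\mathrm{xc}(R_n)\ge 2^{\Omega(n)}$. That is, there are absolute constants $c>0$ and $N\in\mathbb{N}$ such that for every $n\ge N$ and every bounded relaxation $R$ of $\mathrm{QAP}_n$ all of whose points satisfy every QAP5 inequality, $\mathrm{xc}(R)\ge 2^{cn}$. -/

import Mathlib

open scoped ENNReal

noncomputable section

/-- The solution set of a system of linear inequalities `f x ≤ b`, `(f, b) ∈ H`. -/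
def solutionSet {E : Type*} [NormedAddCommGroup E] [NormedSpace ℝ E]
    (H : Set ((E →L[ℝ] ℝ) × ℝ)) : Set E :=
  {x | ∀ h ∈ H, h.1 x ≤ h.2}

/-- A polytope: a bounded solution set of finitely many linear inequalities. -/
def IsPolytope {E : Type*} [NormedAddCommGroup E] [NormedSpace ℝ E] (P : Set E) : Prop :=
  Bornology.IsBounded P ∧ ∃ H : Set ((E →L[ℝ] ℝ) × ℝ), H.Finite ∧ P = solutionSet H

/-- The dimension of the affine hull of a (non-empty) set. -/
def affineDim {E : Type*} [NormedAddCommGroup E] [NormedSpace ℝ E] (P : Set E) : ℕ :=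
  Module.finrank ℝ (affineSpan ℝ P).direction

/-- A facet of `P`: a non-empty face, i.e. the set of maximizers over `P` of some linear
functional, whose dimension is one less than that of `P`. -/
def IsFacet {E : Type*} [NormedAddCommGroup E] [NormedSpace ℝ E] (P F : Set E) : Prop :=
  IsExposed ℝ P F ∧ F.Nonempty ∧ affineDim F + 1 = affineDim P

/-- The size of a polytope: its number of facets. -/
def polytopeSize {E : Type*} [NormedAddCommGroup E] [NormedSpace ℝ E] (P : Set E) : ℕ∞ :=
  {F : Set E | IsFacet P F}.encard

/-- The polytope `Q`, in a space with `r` additional coordinates, is an extended formulation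
of `P`: it projects onto `P`. -/
def IsExtension {E : Type*} [NormedAddCommGroup E] [NormedSpace ℝ E] (P : Set E) {r : ℕ}
    (Q : Set (E × (Fin r → ℝ))) : Prop :=
  IsPolytope Q ∧ P = {x | ∃ y : Fin r → ℝ, (x, y) ∈ Q}

/-- The extension complexity of `P`: the least size of an extended formulation of `P`
(`⊤` if `P` has none, that is, if `P` is not a polytope). -/
def extensionComplexity {E : Type*} [NormedAddCommGroup E] [NormedSpace ℝ E]
    (P : Set E) : ℕ∞ :=
  ⨅ (r : ℕ) (Q : Set (E × (Fin r → ℝ))) (_ : IsExtension P Q), polytopeSize Q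

/-- The space of real `n² × n²` matrices `Y`, with rows and columns indexed by pairs;
`Y (i, j) (k, l)` is the entry `Y_{ij,kl}`. -/
abbrev QAPSpace (n : ℕ) : Type := Fin n × Fin n → Fin n × Fin n → ℝ

/-- The matrix `y yᵀ`, where `y` is the vectorized permutation matrix of `σ`. -/
def qapVertex {n : ℕ} (σ : Equiv.Perm (Fin n)) : QAPSpace n :=
  fun p q => σ.permMatrix ℝ p.1 p.2 * σ.permMatrix ℝ q.1 q.2

/-- The QAP polytope. -/
def qapPolytope (n : ℕ) : Set (QAPSpace n) :=
  convexHull ℝ (Set.range (qapVertex (n := n)))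

/-- `R` is a relaxation of `P`: the solution set of a system of linear inequalities, and
it contains `P`. -/
def IsRelaxation {E : Type*} [NormedAddCommGroup E] [NormedSpace ℝ E] (P R : Set E) : Prop :=
  (∃ H : Set ((E →L[ℝ] ℝ) × ℝ), R = solutionSet H) ∧ P ⊆ R

/-- The matrix `Y` satisfies the QAP5 inequality with integer parameters `β` and `ν i j`. -/
def SatisfiesQAP5 {n : ℕ} (β : ℤ) (ν : Fin n → Fin n → ℤ) (Y : QAPSpace n) : Prop :=
  (∑ i, ∑ j, ∑ k, ∑ l, (ν i j : ℝ) * (ν k l : ℝ) * Y (i, j) (k, l))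
      - (2 * (β : ℝ) - 1) * (∑ i, ∑ j, (ν i j : ℝ) * Y (i, j) (i, j))
    ≥ 1 / 4 - ((β : ℝ) - 1 / 2) ^ 2

end

open Filter Topology

/-! ### Faces and facets of polyhedra -/

section FacetsOfPolytopes

variable {E : Type*} [NormedAddCommGroup E] [NormedSpace ℝ E]

/-! For β = 2 a QAP5 inequality reads (s - 1)(s - 2) ≥ 0 at a vertex yyᵀ, where s = ∑ n_ij y_ij. Fix
m = ⌊n/2⌋ disjoint pairs of indices. A set a of pairs selects 0/1 coefficients, a set b selects the
permutation swapping its pairs, and then s = |a ∩ b|. So the inequality of a is strict at the vertex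
of b when a, b are disjoint, and tight when they share one element (`qapForm_qapVertex`).

Both lift to any extended formulation Q, where a point off the nonempty face of a is missed by some
facet containing that face (`exists_isFacet_of_face`). Each facet F thus gives a rectangle: the a
whose face lies in F, times the b whose point is off F. These rectangles avoid |a ∩ b| = 1 and,
apart from a = ∅, cover the 3^m disjoint pairs; each holds at most 2^m of them
(`sum_disjoint_pairs_rectangle_le`). So Q has at least (3/2)^m - 1 facets. -/

theorem convex_solutionSet (H : Set ((E →L[ℝ] ℝ) × ℝ)) : Convex ℝ (solutionSet H) := by
  intro x hx y hy a b ha hb hab h hh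
  have h1 := hx h hh
  have h2 := hy h hh
  simp only [map_add, map_smul, smul_eq_mul]
  calc a * h.1 x + b * h.1 y ≤ a * h.2 + b * h.2 := by gcongr
    _ = h.2 := by rw [← add_mul, hab, one_mul]

/-- A nonempty convex set on which finitely many linear inequalities hold, each of them strictly
at some point, has a point at which they all hold strictly. -/
theorem Convex.exists_forall_lt {C : Set E} (hC : Convex ℝ C) (hne : C.Nonempty)
    (s : Finset ((E →L[ℝ] ℝ) × ℝ)) (hs : ∀ h ∈ s, ∀ x ∈ C, h.1 x ≤ h.2)
    (hlt : ∀ h ∈ s, ∃ x ∈ C, h.1 x < h.2) : ∃ x ∈ C, ∀ h ∈ s, h.1 x < h.2 := by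
  classical
  induction s using Finset.induction_on with
  | empty => exact ⟨hne.some, hne.some_mem, by simp⟩
  | insert h₀ s _ ih =>
    obtain ⟨x, hx, hxs⟩ := ih (fun h hh => hs h (Finset.mem_insert_of_mem hh))
      (fun h hh => hlt h (Finset.mem_insert_of_mem hh))
    obtain ⟨y, hy, hyh⟩ := hlt h₀ (Finset.mem_insert_self _ _)
    refine ⟨(1 / 2 : ℝ) • x + (1 / 2 : ℝ) • y,
      hC hx hy (by norm_num) (by norm_num) (by norm_num), fun h hh => ?_⟩
    have hx' := hs h hh x hx
    have hy' := hs h hh y hy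
    simp only [map_add, map_smul, smul_eq_mul]
    rcases Finset.mem_insert.1 hh with rfl | hmem
    · linarith
    · linarith [hxs h hmem]

/-- From a point at which finitely many linear inequalities hold strictly, one can move a little
in any direction without violating them. -/
theorem exists_pos_forall_add_smul_le (s : Finset ((E →L[ℝ] ℝ) × ℝ)) (w v : E)
    (hs : ∀ h ∈ s, h.1 w < h.2) : ∃ ε : ℝ, 0 < ε ∧ ∀ h ∈ s, h.1 (w + ε • v) ≤ h.2 := by
  have hev : ∀ᶠ ε : ℝ in 𝓝 0, ∀ h ∈ s, h.1 (w + ε • v) ≤ h.2 := by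
    refine (Finset.eventually_all s).2 fun h hh => ?_
    have hcont : Continuous fun ε : ℝ => h.1 (w + ε • v) := by fun_prop
    have := hcont.tendsto 0
    simp only [zero_smul, add_zero] at this
    exact (this.eventually_lt_const (hs h hh)).mono fun _ => le_of_lt
  have hpos : ∀ᶠ ε : ℝ in 𝓝[>] 0, 0 < ε := self_mem_nhdsWithin
  exact (hpos.and (hev.filter_mono nhdsWithin_le_nhds)).exists

/-- A polyhedron is cut out of its affine span by a finite minimal subsystem. -/
theorem exists_minimal_subsystem (H : Set ((E →L[ℝ] ℝ) × ℝ)) (hH : H.Finite) :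
    ∃ s : Finset ((E →L[ℝ] ℝ) × ℝ),
      (∀ x, x ∈ solutionSet H ↔ x ∈ affineSpan ℝ (solutionSet H) ∧ ∀ h ∈ s, h.1 x ≤ h.2) ∧
      ∀ h ∈ s, ∃ z ∈ affineSpan ℝ (solutionSet H), h.2 < h.1 z ∧
        ∀ h' ∈ s, h' ≠ h → h'.1 z ≤ h'.2 := by
  classical
  obtain ⟨s, hs⟩ := exists_minimal_of_wellFoundedLT
    (fun s : Finset ((E →L[ℝ] ℝ) × ℝ) => ∀ x, x ∈ solutionSet H ↔
      x ∈ affineSpan ℝ (solutionSet H) ∧ ∀ h ∈ s, h.1 x ≤ h.2)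
    ⟨hH.toFinset, fun x => ⟨fun hx => ⟨subset_affineSpan ℝ _ hx, fun h hh =>
      hx h (hH.mem_toFinset.1 hh)⟩, fun hx h hh => hx.2 h (hH.mem_toFinset.2 hh)⟩⟩
  refine ⟨s, hs.prop, fun h hh => ?_⟩
  by_contra! hcon
  have herase : ∀ x, x ∈ solutionSet H ↔
      x ∈ affineSpan ℝ (solutionSet H) ∧ ∀ h' ∈ s.erase h, h'.1 x ≤ h'.2 := by
    intro x
    rw [hs.prop x]
    refine and_congr_right fun hx => ⟨fun hx' h' hh' => hx' h' (Finset.mem_of_mem_erase hh'),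
      fun hx' h' hh' => ?_⟩
    by_cases he : h' = h
    · subst he
      by_contra! hlt
      obtain ⟨h'', hm, hne, hlt'⟩ := hcon x hx hlt
      exact absurd (hx' h'' (Finset.mem_erase.2 ⟨hne, hm⟩)) (not_le.2 hlt')
    · exact hx' h' (Finset.mem_erase.2 ⟨he, hh'⟩)
  exact Finset.notMem_erase h s (hs.le_of_le herase (Finset.erase_subset h s) hh)

/-- If `x₀` satisfies all inequalities of a system strictly and `z` violates exactly one, then
that one is attained on the segment between them at a point strictly satisfying the others. -/
theorem exists_eq_and_forall_lt {A : AffineSubspace ℝ E} {s : Finset ((E →L[ℝ] ℝ) × ℝ)}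
    {h : (E →L[ℝ] ℝ) × ℝ} (hh : h ∈ s) {x₀ z : E} (hx₀ : x₀ ∈ A) (hz : z ∈ A)
    (hx₀s : ∀ h' ∈ s, h'.1 x₀ < h'.2) (hzh : h.2 < h.1 z)
    (hzs : ∀ h' ∈ s, h' ≠ h → h'.1 z ≤ h'.2) :
    ∃ w ∈ A, h.1 w = h.2 ∧ ∀ h' ∈ s, h' ≠ h → h'.1 w < h'.2 := by
  have h0 := hx₀s h hh
  have hd : 0 < h.1 z - h.1 x₀ := by linarith
  set t : ℝ := (h.2 - h.1 x₀) / (h.1 z - h.1 x₀) with ht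
  have ht0 : 0 < t := div_pos (by linarith) hd
  have ht1 : t < 1 := (div_lt_one hd).2 (by linarith)
  have hval : ∀ g : E →L[ℝ] ℝ, g (AffineMap.lineMap x₀ z t) = g x₀ + t * (g z - g x₀) := by
    intro g
    simp only [AffineMap.lineMap_apply_module', map_add, map_smul, map_sub, smul_eq_mul]
    ring
  refine ⟨AffineMap.lineMap x₀ z t, AffineMap.lineMap_mem t hx₀ hz, ?_, fun h' hh' hne => ?_⟩
  · rw [hval, ht, div_mul_cancel₀ _ hd.ne']
    ring
  · rw [hval]
    nlinarith [hx₀s h' hh', hzs h' hh' hne]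

theorem finrank_inf_ker_add_one [FiniteDimensional ℝ E] (D : Submodule ℝ E) (g : E →L[ℝ] ℝ)
    {v : E} (hv : v ∈ D) (hgv : g v ≠ 0) :
    Module.finrank ℝ (D ⊓ LinearMap.ker (g : E →ₗ[ℝ] ℝ) : Submodule ℝ E) + 1
      = Module.finrank ℝ D := by
  have hne : (g : E →ₗ[ℝ] ℝ).domRestrict D ≠ 0 := fun h0 =>
    hgv (by simpa using LinearMap.congr_fun h0 ⟨v, hv⟩)
  rw [← Module.Dual.finrank_ker_add_one_of_ne_zero hne, LinearMap.ker_domRestrict,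
    ← Submodule.finrank_map_subtype_eq, Submodule.map_comap_subtype]

/-- An inequality of a system that is attained at a point `w` strictly satisfying the other
inequalities, but is not constant on the affine span, defines a facet. -/
theorem isFacet_of_eq_and_forall_lt [FiniteDimensional ℝ E] {Q : Set E}
    {s : Finset ((E →L[ℝ] ℝ) × ℝ)}
    (hQ : ∀ x, x ∈ Q ↔ x ∈ affineSpan ℝ Q ∧ ∀ h ∈ s, h.1 x ≤ h.2)
    {h : (E →L[ℝ] ℝ) × ℝ} (hh : h ∈ s) {w z : E} (hw : w ∈ affineSpan ℝ Q) (hwh : h.1 w = h.2)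
    (hws : ∀ h' ∈ s, h' ≠ h → h'.1 w < h'.2) (hz : z ∈ affineSpan ℝ Q) (hzh : h.2 < h.1 z) :
    IsFacet Q {x ∈ Q | h.1 x = h.2} := by
  classical
  have hwQ : w ∈ Q := by
    refine (hQ w).2 ⟨hw, fun h' hh' => ?_⟩
    by_cases he : h' = h
    · exact he ▸ hwh.le
    · exact (hws h' hh' he).le
  have hwF : w ∈ {x ∈ Q | h.1 x = h.2} := ⟨hwQ, hwh⟩
  refine ⟨fun _ => ⟨h.1, ?_⟩, ⟨w, hwF⟩, ?_⟩
  · ext x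
    refine ⟨fun hx => ⟨hx.1, fun y hy => ?_⟩, fun hx => ⟨hx.1, le_antisymm ?_ ?_⟩⟩
    · rw [hx.2]
      exact ((hQ y).1 hy).2 h hh
    · exact ((hQ x).1 hx.1).2 h hh
    · rw [← hwh]
      exact hx.2 w hwQ
  · have hdir : (affineSpan ℝ {x ∈ Q | h.1 x = h.2}).direction
        = (affineSpan ℝ Q).direction ⊓ LinearMap.ker (h.1 : E →ₗ[ℝ] ℝ) := by
      apply le_antisymm
      · refine le_inf (AffineSubspace.direction_le (affineSpan_mono ℝ fun x hx => hx.1)) ?_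
        rw [direction_affineSpan, vectorSpan_def, Submodule.span_le]
        rintro _ ⟨x, hx, y, hy, rfl⟩
        simp [hx.2, hy.2]
      · rintro v ⟨hvA, hvk⟩
        have hvk' : h.1 v = 0 := hvk
        -- All other inequalities have slack at `w`, so a small move along `v` stays in the face.
        obtain ⟨ε, hε, hεs⟩ := exists_pos_forall_add_smul_le (s.erase h) w v
          (fun h' hh' => hws h' (Finset.mem_of_mem_erase hh') (Finset.ne_of_mem_erase hh'))
        have hval : h.1 (w + ε • v) = h.2 := by simp [hvk', hwh]
        have hmem : w + ε • v ∈ {x ∈ Q | h.1 x = h.2} := by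
          refine ⟨(hQ _).2 ⟨?_, fun h' hh' => ?_⟩, hval⟩
          · rw [add_comm]
            exact AffineSubspace.vadd_mem_of_mem_direction (Submodule.smul_mem _ ε hvA) hw
          · by_cases he : h' = h
            · exact he ▸ hval.le
            · exact hεs h' (Finset.mem_erase.2 ⟨he, hh'⟩)
        have hsub := AffineSubspace.vsub_mem_direction (subset_affineSpan ℝ _ hmem)
          (subset_affineSpan ℝ _ hwF)
        rw [vsub_eq_sub, add_sub_cancel_left] at hsub
        exact (Submodule.smul_mem_iff _ hε.ne').1 hsub
    rw [affineDim, affineDim, hdir]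
    refine finrank_inf_ker_add_one _ h.1 (AffineSubspace.vsub_mem_direction hz hw) ?_
    rw [vsub_eq_sub, map_sub, hwh]
    linarith

/-- A point of a polyhedron outside a nonempty face is separated from the face by a facet. -/
theorem exists_isFacet_of_face [FiniteDimensional ℝ E] {H : Set ((E →L[ℝ] ℝ) × ℝ)}
    (hH : H.Finite) (f : E →ₗ[ℝ] ℝ) (c : ℝ) (hf : ∀ x ∈ solutionSet H, f x ≤ c)
    (hne : ∃ x ∈ solutionSet H, f x = c) {q : E} (hq : q ∈ solutionSet H) (hfq : f q < c) :
    ∃ F, IsFacet (solutionSet H) F ∧ (∀ x ∈ solutionSet H, f x = c → x ∈ F) ∧ q ∉ F := by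
  classical
  obtain ⟨s, hs, hmin⟩ := exists_minimal_subsystem H hH
  have hle : ∀ h ∈ s, ∀ x ∈ solutionSet H, h.1 x ≤ h.2 := fun h hh x hx => ((hs x).1 hx).2 h hh
  -- Equality throughout the polyhedron would extend to its affine span, where irredundancy supplies
  -- a violating `z`.
  have hstrict : ∀ h ∈ s, ∃ x ∈ solutionSet H, h.1 x < h.2 := by
    intro h hh
    by_contra! hcon
    obtain ⟨z, hz, hzh, -⟩ := hmin h hh
    have hEq : Set.EqOn h.1.toLinearMap.toAffineMap (AffineMap.const ℝ E h.2)
        (solutionSet H) := fun x hx => le_antisymm (hle h hh x hx) (hcon x hx)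
    have hEq' : h.1 z = h.2 := AffineMap.eqOn_affineSpan hEq hz
    exact hzh.ne' hEq'
  obtain ⟨x₀, hx₀, hx₀s⟩ := (convex_solutionSet H).exists_forall_lt ⟨q, hq⟩ s hle hstrict
  have hG : Convex ℝ {x ∈ solutionSet H | f x = c} := by
    have : {x ∈ solutionSet H | f x = c} = solutionSet H ∩ f ⁻¹' {c} := rfl
    rw [this]
    exact (convex_solutionSet H).inter ((convex_singleton c).linear_preimage f)
  -- `g` acts as a relative interior point of the face.
  obtain ⟨g, hg, hgs⟩ := hG.exists_forall_lt hne
    (s.filter fun h => ∃ x ∈ {x ∈ solutionSet H | f x = c}, h.1 x < h.2)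
    (fun h hh x hx => hle h (Finset.mem_filter.1 hh).1 x hx.1)
    (fun h hh => (Finset.mem_filter.1 hh).2)
  obtain ⟨h, hh, htight, hhq⟩ : ∃ h ∈ s, (∀ x ∈ solutionSet H, f x = c → h.1 x = h.2) ∧
      h.1 q ≠ h.2 := by
    by_contra! hcon
    -- If everything tight on the face were tight at `q`, then `g` could be pushed away from `q`
    -- inside the polyhedron, raising `f` above `c`.
    obtain ⟨ε, hε, hεs⟩ := exists_pos_forall_add_smul_le _ g (g - q) hgs
    have hmem : g + ε • (g - q) ∈ solutionSet H := by
      refine (hs _).2 ⟨?_, fun h hh => ?_⟩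
      · rw [add_comm]
        exact AffineSubspace.vadd_mem_of_mem_direction (Submodule.smul_mem _ ε
          (AffineSubspace.vsub_mem_direction (subset_affineSpan ℝ _ hg.1)
            (subset_affineSpan ℝ _ hq))) (subset_affineSpan ℝ _ hg.1)
      · by_cases hex : ∃ x ∈ {x ∈ solutionSet H | f x = c}, h.1 x < h.2
        · exact hεs h (Finset.mem_filter.2 ⟨hh, hex⟩)
        · push Not at hex
          have ht : ∀ x ∈ solutionSet H, f x = c → h.1 x = h.2 := fun x hx hfx =>
            le_antisymm (hle h hh x hx) (hex x ⟨hx, hfx⟩)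
          simp [ht g hg.1 hg.2, hcon h hh ht]
    have hbound := hf _ hmem
    simp only [map_add, map_smul, map_sub, smul_eq_mul, hg.2] at hbound
    nlinarith [mul_pos hε (sub_pos.2 hfq)]
  obtain ⟨z, hz, hzh, hzs⟩ := hmin h hh
  obtain ⟨w, hw, hwh, hws⟩ := exists_eq_and_forall_lt hh (subset_affineSpan ℝ _ hx₀) hz hx₀s
    hzh hzs
  exact ⟨_, isFacet_of_eq_and_forall_lt hs hh hw hwh hws hz hzh,
    fun x hx hfx => ⟨hx, htight x hx hfx⟩, fun hqF => hhq hqF.2⟩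

end FacetsOfPolytopes

/-! ### Covering disjoint pairs by rectangles -/

section UniqueDisjointness

/-- The size of the intersection of two sets, given by their indicator functions. -/
def interCard {m : ℕ} (a b : Fin m → Bool) : ℕ := ∑ k, if a k ∧ b k then 1 else 0

theorem interCard_cons {m : ℕ} (x y : Bool) (a b : Fin m → Bool) :
    interCard (Fin.cons x a : Fin (m + 1) → Bool) (Fin.cons y b)
      = (if x ∧ y then 1 else 0) + interCard a b := by
  simp only [interCard, Fin.sum_univ_succ, Fin.cons_zero, Fin.cons_succ]

theorem sum_fin_succ_bool {m : ℕ} (f : (Fin (m + 1) → Bool) → ℕ) :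
    ∑ a, f a = ∑ a : Fin m → Bool, (f (Fin.cons true a) + f (Fin.cons false a)) := by
  rw [← (Fin.consEquiv fun _ : Fin (m + 1) => Bool).sum_comp, Fintype.sum_prod_type,
    Fintype.sum_bool, ← Finset.sum_add_distrib]
  rfl

/-- Each element lies in the first set only, the second only, or neither. -/
theorem sum_disjoint_pairs (m : ℕ) :
    ∑ a : Fin m → Bool, ∑ b, (if interCard a b = 0 then 1 else 0) = 3 ^ m := by
  induction m with
  | zero => simp [interCard]
  | succ m ih =>
    simp only [sum_fin_succ_bool, interCard_cons]
    rw [pow_succ, ← ih, Finset.sum_mul]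
    refine Finset.sum_congr rfl fun a _ => ?_
    rw [Finset.sum_mul, ← Finset.sum_add_distrib]
    refine Finset.sum_congr rfl fun b _ => ?_
    by_cases h : interCard a b = 0 <;> simp [h]

open Classical in
/-- A combinatorial rectangle without pairs meeting in exactly one element contains at most `2 ^ m`
disjoint pairs. -/
theorem sum_disjoint_pairs_rectangle_le (m : ℕ) (A B : (Fin m → Bool) → Prop)
    (hAB : ∀ a b, A a → B b → interCard a b ≠ 1) :
    ∑ a, ∑ b, (if A a ∧ B b ∧ interCard a b = 0 then 1 else 0) ≤ 2 ^ m := by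
  induction m with
  | zero =>
    simp only [Finset.univ_unique, Finset.sum_singleton, pow_zero]
    split_ifs <;> simp
  | succ m ih =>
    -- A disjoint pair starts with bits (0,0), (0,1) or (1,0). The two smaller rectangles are the
    -- projections of the parts with first bit 0 in `a`, respectively in `b`.
    have h1 := ih (fun a => A (Fin.cons false a))
      (fun b => B (Fin.cons false b) ∨ B (Fin.cons true b)) (by
        rintro a b ha (hb | hb) h
        · exact hAB _ _ ha hb (by simp [interCard_cons, h])
        · exact hAB _ _ ha hb (by simp [interCard_cons, h]))
    have h2 := ih (fun a => A (Fin.cons false a) ∨ A (Fin.cons true a))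
      (fun b => B (Fin.cons false b)) (by
        rintro a b (ha | ha) hb h
        · exact hAB _ _ ha hb (by simp [interCard_cons, h])
        · exact hAB _ _ ha hb (by simp [interCard_cons, h]))
    rw [pow_succ, mul_two]
    refine le_trans ?_ (add_le_add h1 h2)
    simp only [sum_fin_succ_bool, interCard_cons, ← Finset.sum_add_distrib]
    refine Finset.sum_le_sum fun a _ => Finset.sum_le_sum fun b _ => ?_
    by_cases h : interCard a b = 0
    · have hTT : ¬ (A (Fin.cons true a) ∧ B (Fin.cons true b)) := fun hab =>
        hAB _ _ hab.1 hab.2 (by simp [interCard_cons, h])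
      by_cases h1 : A (Fin.cons true a) <;> by_cases h2 : A (Fin.cons false a) <;>
        by_cases h3 : B (Fin.cons true b) <;> by_cases h4 : B (Fin.cons false b) <;>
        simp_all
    · simp [h]

/-- Rectangles that cover all disjoint pairs and contain no pair meeting in exactly one element
are at least `(3 / 2) ^ m` in number. -/
theorem three_pow_le_card_mul_two_pow {m : ℕ} {ι : Type*} [Fintype ι]
    (A B : ι → (Fin m → Bool) → Prop)
    (hAB : ∀ i a b, A i a → B i b → interCard a b ≠ 1)
    (hcover : ∀ a b, interCard a b = 0 → ∃ i, A i a ∧ B i b) :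
    3 ^ m ≤ Fintype.card ι * 2 ^ m := by
  classical
  calc 3 ^ m = ∑ a : Fin m → Bool, ∑ b, (if interCard a b = 0 then 1 else 0) :=
        (sum_disjoint_pairs m).symm
    _ ≤ ∑ a, ∑ b, ∑ i, (if A i a ∧ B i b ∧ interCard a b = 0 then 1 else 0) := by
        refine Finset.sum_le_sum fun a _ => Finset.sum_le_sum fun b _ => ?_
        split_ifs with h
        · obtain ⟨i, hi⟩ := hcover a b h
          refine le_trans ?_ (Finset.single_le_sum (fun _ _ => Nat.zero_le _)
            (Finset.mem_univ i))
          simp [hi, h]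
        · exact Nat.zero_le _
    _ = ∑ i, ∑ a, ∑ b, (if A i a ∧ B i b ∧ interCard a b = 0 then 1 else 0) :=
        (Finset.sum_congr rfl fun _ _ => Finset.sum_comm).trans Finset.sum_comm
    _ ≤ ∑ _i : ι, 2 ^ m :=
        Finset.sum_le_sum fun i _ => sum_disjoint_pairs_rectangle_le m _ _ (hAB i)
    _ = Fintype.card ι * 2 ^ m := by simp

end UniqueDisjointness

/-! ### From rectangles to facets -/

/-- If a polyhedron `Q` has, for every set `b`, a point `p b` and, for every set `a`, a valid
inequality `f a x ≤ c` that `p b` satisfies strictly when `a`, `b` are disjoint and with equality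
when they meet in one element, then `Q` has at least `(3 / 2) ^ m - 1` facets. -/
theorem three_pow_le_ncard_facets {E : Type*} [NormedAddCommGroup E] [NormedSpace ℝ E]
    [FiniteDimensional ℝ E] {m : ℕ} {H : Set ((E →L[ℝ] ℝ) × ℝ)} (hH : H.Finite)
    (f : (Fin m → Bool) → E →ₗ[ℝ] ℝ) (c : ℝ) (p : (Fin m → Bool) → E)
    (hp : ∀ b, p b ∈ solutionSet H) (hf : ∀ a, ∀ x ∈ solutionSet H, f a x ≤ c)
    (h0 : ∀ a b, interCard a b = 0 → f a (p b) < c)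
    (h1 : ∀ a b, interCard a b = 1 → f a (p b) = c)
    (hfin : {F | IsFacet (solutionSet H) F}.Finite) :
    3 ^ m ≤ ({F | IsFacet (solutionSet H) F}.ncard + 1) * 2 ^ m := by
  classical
  have := hfin.fintype
  -- The extra index `none` covers the empty set `a`, whose face may be empty; it costs the + 1.
  have key := three_pow_le_card_mul_two_pow
    (ι := Option {F | IsFacet (solutionSet H) F})
    (fun i a => i.elim (a = fun _ => false)
      fun F => ∀ x ∈ solutionSet H, f a x = c → x ∈ F.1)
    (fun i b => i.elim True fun F => p b ∉ F.1) ?_ ?_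
  · rwa [Fintype.card_option, ← Set.toFinset_card, ← Set.ncard_eq_toFinset_card'] at key
  · rintro (_ | F) a b ha hb hab
    · have ha' : a = fun _ => false := ha
      simp [ha', interCard] at hab
    · exact hb (ha _ (hp b) (h1 a b hab))
  · intro a b hab
    by_cases ha : a = fun _ => false
    · exact ⟨none, ha, trivial⟩
    · obtain ⟨k, hk⟩ : ∃ k, a k = true := by
        by_contra! hcon
        exact ha (funext fun k => by simpa using hcon k)
      -- A singleton inside `a` shows that the face of `a` is nonempty.
      have hk1 : interCard a (fun j => decide (j = k)) = 1 := by
        rw [interCard, Finset.sum_eq_single k]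
        · simp [hk]
        · intro j _ hj
          simp [hj]
        · simp
      obtain ⟨F, hF, hFa, hFb⟩ := exists_isFacet_of_face hH (f a) c (hf a)
        ⟨_, hp _, h1 a _ hk1⟩ (hp b) (h0 a b hab)
      exact ⟨some ⟨F, hF⟩, hFa, hFb⟩

/-! ### Unique disjointness inside the QAP polytope -/

section Embedding

variable {m n : ℕ}

/-- The permutation that swaps `e (k, false)` and `e (k, true)` for all `k` in the set `b`. -/
noncomputable def swapPerm (e : Fin m × Bool ↪ Fin n) (b : Fin m → Bool) : Equiv.Perm (Fin n) :=
  Equiv.Perm.viaEmbedding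
    (Function.Involutive.toPerm (fun x : Fin m × Bool => (x.1, xor x.2 (b x.1)))
      (fun x => by simp)) e

/-- The coefficients of the QAP5 inequality that belongs to the set `a`. -/
def qapCoeff (e : Fin m × Bool ↪ Fin n) (a : Fin m → Bool) (i j : Fin n) : ℤ :=
  ∑ k, if a k ∧ i = e (k, false) ∧ j = e (k, true) then 1 else 0

theorem sum_qapCoeff_mul (e : Fin m × Bool ↪ Fin n) (a : Fin m → Bool)
    (g : Fin n → Fin n → ℝ) :
    ∑ i, ∑ j, (qapCoeff e a i j : ℝ) * g i j
      = ∑ k, if a k then g (e (k, false)) (e (k, true)) else 0 := by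
  simp only [qapCoeff, Int.cast_sum, Finset.sum_mul]
  simp_rw [Finset.sum_comm (s := (Finset.univ : Finset (Fin n)))
    (t := (Finset.univ : Finset (Fin m)))]
  refine Finset.sum_congr rfl fun k _ => ?_
  rw [Finset.sum_eq_single (e (k, false)), Finset.sum_eq_single (e (k, true))]
  · by_cases h : a k <;> simp [h]
  · intro j _ hj
    simp [hj]
  · simp
  · intro i _ hi
    simp [hi]
  · simp

theorem swapPerm_apply (e : Fin m × Bool ↪ Fin n) (b : Fin m → Bool) (k : Fin m) :
    swapPerm e b (e (k, false)) = e (k, b k) := by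
  rw [swapPerm, Equiv.Perm.viaEmbedding_apply]
  exact congrArg e (Prod.ext rfl (Bool.false_xor _))

theorem sum_qapCoeff_mul_swapPerm (e : Fin m × Bool ↪ Fin n) (a b : Fin m → Bool) :
    ∑ i, ∑ j, (qapCoeff e a i j : ℝ) * (if swapPerm e b i = j then 1 else 0)
      = interCard a b := by
  rw [sum_qapCoeff_mul e a fun i j => if swapPerm e b i = j then 1 else 0, interCard]
  push_cast
  refine Finset.sum_congr rfl fun k _ => ?_
  rw [swapPerm_apply]
  by_cases h : a k <;> simp [h]

theorem qapVertex_apply (σ : Equiv.Perm (Fin n)) (p q : Fin n × Fin n) :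
    qapVertex σ p q = (if σ p.1 = p.2 then 1 else 0) * (if σ q.1 = q.2 then 1 else 0) := by
  have h : ∀ i j, σ.permMatrix ℝ i j = if σ i = j then 1 else 0 := fun i j => by
    rw [Equiv.Perm.permMatrix, PEquiv.toMatrix_apply, Equiv.toPEquiv_apply]
    simp only [Option.mem_some_iff]
  rw [qapVertex, h, h]

/-- The QAP5 inequality for the coefficients `ν` and `β = 2` says that this linear form is at
most `2`. -/
noncomputable def qapForm (ν : Fin n → Fin n → ℤ) : QAPSpace n →ₗ[ℝ] ℝ where
  toFun Y := 3 * (∑ i, ∑ j, (ν i j : ℝ) * Y (i, j) (i, j))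
    - ∑ i, ∑ j, ∑ k, ∑ l, (ν i j : ℝ) * (ν k l : ℝ) * Y (i, j) (k, l)
  map_add' Y Z := by
    simp only [Pi.add_apply, mul_add, Finset.sum_add_distrib]
    ring
  map_smul' r Y := by
    simp only [Pi.smul_apply, smul_eq_mul, RingHom.id_apply, mul_sub, Finset.mul_sum]
    congr 1 <;> simp only [mul_left_comm]

theorem SatisfiesQAP5.qapForm_le {ν : Fin n → Fin n → ℤ} {Y : QAPSpace n}
    (h : SatisfiesQAP5 2 ν Y) : qapForm ν Y ≤ 2 := by
  unfold SatisfiesQAP5 at h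
  simp only [qapForm, LinearMap.coe_mk, AddHom.coe_mk]
  push_cast at h
  linarith

/-- On a rank-one 0/1 matrix the diagonal entries are linear in `X` and the quadratic term is a
perfect square. -/
theorem qapForm_eq {ν : Fin n → Fin n → ℤ} {Y : QAPSpace n} {X : Fin n → Fin n → ℝ}
    (hY : ∀ p q, Y p q = X p.1 p.2 * X q.1 q.2) (hX : ∀ i j, X i j * X i j = X i j) {s : ℝ}
    (hs : ∑ i, ∑ j, (ν i j : ℝ) * X i j = s) : qapForm ν Y = 3 * s - s ^ 2 := by
  simp only [qapForm, LinearMap.coe_mk, AddHom.coe_mk, hY, hX]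
  rw [hs, sq]
  congr 1
  conv_rhs => rw [← hs]
  simp only [Finset.sum_mul]
  refine Finset.sum_congr rfl fun i _ => Finset.sum_congr rfl fun j _ => ?_
  simp only [Finset.mul_sum]
  refine Finset.sum_congr rfl fun k _ => Finset.sum_congr rfl fun l _ => ?_
  ring

theorem qapForm_qapVertex (e : Fin m × Bool ↪ Fin n) (a b : Fin m → Bool) :
    qapForm (qapCoeff e a) (qapVertex (swapPerm e b))
      = 3 * (interCard a b : ℝ) - (interCard a b : ℝ) ^ 2 :=
  qapForm_eq (X := fun i j => if swapPerm e b i = j then 1 else 0) (qapVertex_apply _)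
    (fun i j => by split_ifs <;> norm_num) (sum_qapCoeff_mul_swapPerm e a b)

end Embedding

/-! ### Numerical bounds and conclusion -/

theorem five_quarters_pow_le_of_three_pow_le {m k : ℕ} (hm : 3 ≤ m)
    (h : 3 ^ m ≤ (k + 1) * 2 ^ m) : (5 / 4 : ℝ) ^ m ≤ k := by
  -- Lowering the base from 3/2 to 5/4 absorbs the + 1; this first works at m = 3.
  have h1 : (5 / 4 : ℝ) ^ m + 1 ≤ (3 / 2 : ℝ) ^ m := by
    clear h
    induction m, hm using Nat.le_induction with
    | base => norm_num
    | succ m _ ih =>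
      rw [pow_succ, pow_succ]
      nlinarith [pow_pos (show (0 : ℝ) < 5 / 4 by norm_num) m]
  have h2 : (3 / 2 : ℝ) ^ m ≤ k + 1 := by
    rw [div_pow, div_le_iff₀ (by positivity)]
    exact_mod_cast h
  linarith

theorem five_quarters_pow_le_polytopeSize {n r m : ℕ} (hm : 3 ≤ m) (hmn : m * 2 ≤ n)
    {R : Set (QAPSpace n)} (hR : qapPolytope n ⊆ R)
    (hvalid : ∀ (β : ℤ) (ν : Fin n → Fin n → ℤ), ∀ Y ∈ R, SatisfiesQAP5 β ν Y)
    {Q : Set (QAPSpace n × (Fin r → ℝ))} (hQ : IsExtension R Q) :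
    ((⌈(5 / 4 : ℝ) ^ m⌉₊ : ℕ) : ℕ∞) ≤ polytopeSize Q := by
  obtain ⟨⟨-, H, hH, rfl⟩, hproj⟩ := hQ
  obtain ⟨e⟩ : Nonempty (Fin m × Bool ↪ Fin n) :=
    Function.Embedding.nonempty_of_card_le (by simpa using hmn)
  have hlift : ∀ b : Fin m → Bool, ∃ y : Fin r → ℝ,
      (qapVertex (swapPerm e b), y) ∈ solutionSet H := by
    intro b
    have hb : qapVertex (swapPerm e b) ∈ R := hR (subset_convexHull ℝ _ ⟨_, rfl⟩)
    rw [hproj] at hb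
    exact hb
  choose y hy using hlift
  rcases Set.finite_or_infinite {F | IsFacet (solutionSet H) F} with hfin | hinf
  · have hcount := three_pow_le_ncard_facets hH
      (fun a => qapForm (qapCoeff e a) ∘ₗ LinearMap.fst ℝ (QAPSpace n) (Fin r → ℝ)) 2
      (fun b => (qapVertex (swapPerm e b), y b)) hy ?_ ?_ ?_ hfin
    · rw [polytopeSize, ← hfin.cast_ncard_eq, Nat.cast_le, Nat.ceil_le]
      exact five_quarters_pow_le_of_three_pow_le hm hcount
    · rintro a ⟨Y, z⟩ hx
      exact (hvalid 2 (qapCoeff e a) Y (by rw [hproj]; exact ⟨z, hx⟩)).qapForm_le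
    · intro a b hab
      simp [qapForm_qapVertex, hab]
    · intro a b hab
      simp only [LinearMap.comp_apply, LinearMap.fst_apply, qapForm_qapVertex, hab]
      norm_num
  · rw [polytopeSize, hinf.encard_eq]
    exact le_top

theorem two_rpow_le_ceil {n m : ℕ} (hnm : n ≤ 2 * m + 1) (hm : 3 ≤ m) :
    (2 : ℝ≥0∞) ^ ((1 / 10 : ℝ) * (n : ℝ)) ≤ ((⌈(5 / 4 : ℝ) ^ m⌉₊ : ℕ) : ℝ≥0∞) := by
  have hreal : (2 : ℝ) ^ ((1 / 10 : ℝ) * (n : ℝ)) ≤ (⌈(5 / 4 : ℝ) ^ m⌉₊ : ℕ) := by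
    have hn' : (n : ℝ) ≤ 2 * m + 1 := by exact_mod_cast hnm
    have hm' : (3 : ℝ) ≤ m := by exact_mod_cast hm
    have hroot : (2 : ℝ) ^ (1 / 4 : ℝ) ≤ 5 / 4 := by
      calc (2 : ℝ) ^ (1 / 4 : ℝ) ≤ ((5 / 4 : ℝ) ^ (4 : ℝ)) ^ (1 / 4 : ℝ) :=
            Real.rpow_le_rpow (by norm_num) (by norm_num) (by norm_num)
        _ = 5 / 4 := by rw [← Real.rpow_mul (by norm_num)]; norm_num
    -- The exponents compare because (2m + 1)/10 ≤ m/4 for m ≥ 2.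
    calc (2 : ℝ) ^ ((1 / 10 : ℝ) * (n : ℝ)) ≤ (2 : ℝ) ^ ((1 / 4 : ℝ) * m) :=
          Real.rpow_le_rpow_of_exponent_le (by norm_num) (by linarith)
      _ = ((2 : ℝ) ^ (1 / 4 : ℝ)) ^ m := by
          rw [Real.rpow_mul (by norm_num), Real.rpow_natCast]
      _ ≤ (5 / 4 : ℝ) ^ m := pow_le_pow_left₀ (by positivity) hroot m
      _ ≤ _ := Nat.le_ceil _
  have h2 : (2 : ℝ≥0∞) = ENNReal.ofReal 2 := by simp
  rw [h2, ENNReal.ofReal_rpow_of_pos (by norm_num), ← ENNReal.ofReal_natCast]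
  exact ENNReal.ofReal_le_ofReal hreal

theorem mainTheorem6 :
    ∃ c : ℝ, 0 < c ∧ ∃ N : ℕ, ∀ n : ℕ, N ≤ n →
      ∀ R : Set (QAPSpace n),
        IsRelaxation (qapPolytope n) R →
        Bornology.IsBounded R →
        (∀ (β : ℤ) (ν : Fin n → Fin n → ℤ), ∀ Y ∈ R, SatisfiesQAP5 β ν Y) →
        (2 : ℝ≥0∞) ^ (c * (n : ℝ)) ≤ ((extensionComplexity R : ℕ∞) : ℝ≥0∞) := by
  -- n ≥ 6 ensures ⌊n/2⌋ ≥ 3.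
  refine ⟨1 / 10, by norm_num, 6, fun n hn R hR _ hvalid => ?_⟩
  have hle : ((⌈(5 / 4 : ℝ) ^ (n / 2)⌉₊ : ℕ) : ℕ∞) ≤ extensionComplexity R :=
    le_iInf fun r => le_iInf fun Q => le_iInf fun hQ =>
      five_quarters_pow_le_polytopeSize (by omega) (by omega) hR.2 hvalid hQ
  refine (two_rpow_le_ceil (m := n / 2) (by omega) (by omega)).trans ?_
  exact_mod_cast ENat.toENNReal_le.2 hle
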